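/- Let $K$ be a field (for instance $K=\mathbb{C}$), let $1\le k\le \ell$ be integers, and let $q\in K$, $q\neq 0$, with $q^{2m}\neq 1$ for $1\le m\le \ell$. Let $H_{n}(q)$ be the Hecke algebra over $K$, i.e. the unital associative algebra with generators $\sigma_1,\dots,\sigma_{n-1}$ and relations $\sigma_i^2=(q-q^{-1})\sigma_i+1$, $\sigma_i\sigma_{i+1}\sigma_i=\sigma_{i+1}\sigma_i\sigma_{i+1}$, and $\sigma_i\sigma_j=\sigma_j\sigma_i$ for $|i-j|>1$. In $H_n(q)$ put $$\sigma_i^\circ=-q\,\sigma_i,\qquad R_i^\circ(u)=\frac{1-u}{q^2-u}\,\sigma_i^\circ+\frac{q^2-1}{q^2-u},$$ $$S^\circ_{[i,j]}=\prod_{i\le a\le j-1}^{\longrightarrow}R^\circ_a(q^{-2(a-i+1)})\,R^\circ_{a-1}(q^{-2(a-i)})\cdots R^\circ_i(q^{-2}),$$ where the arrow $\longrightarrow$ (resp. $\longleftarrow$) means that the factors are ordered from left to right (resp. from right to left) as $a$ increases. In $H_{k+\ell}(q)$ put $P^{\circ(k,\ell)}=S^\circ_{[1,k]}S^\circ_{[k+1,k+\ell]}$,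 $P^{\circ(\ell,k)}=S^\circ_{[1,\ell]}S^\circ_{[\ell+1,k+\ell]}$, $$R^{\circ(k,\ell)}(u)=P^{\circ(k,\ell)}\prod_{1\le a\le k}^{\longleftarrow}R^\circ_a\big(uq^{-2(1-a)}\big)R^\circ_{a+1}\big(uq^{-2(2-a)}\big)\cdots R^\circ_{a+\ell-1}\big(uq^{-2(\ell-a)}\big)\;P^{\circ(\ell,k)},$$ and, for $0\le p\le k$, $$\Sigma^{\circ(k,\ell;p)}=P^{\circ(k,\ell)}(\sigma^\circ_k\sigma^\circ_{k+1}\cdots\sigma^\circ_{\ell+p-1})(\sigma^\circ_{k-1}\sigma^\circ_k\cdots\sigma^\circ_{\ell+p-2})\cdots(\sigma^\circ_{k-p+1}\sigma^\circ_{k-p+2}\cdots\sigma^\circ_\ell)P^{\circ(\ell,k)}.$$ Let $[n]_{q^2}=\frac{1-q^{2n}}{1-q^2}$, $[n]_{q^2}!=[1]_{q^2}\cdots[n]_{q^2}$, $\binom{n}{m}_{q^2}=\frac{[n]_{q^2}!}{[m]_{q^2}!\,[n-m]_{q^2}!}$, $(a;q^2)_n=\prod_{j=0}^{n-1}(1-aq^{2j})$,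 let $$\varphi_{\mu,\nu}(p|k)=\binom{k}{p}_{q^2}\mu^p\,\frac{(\mu;q^2)_{k-p}\,(\nu/\mu;q^2)_p}{(\nu;q^2)_k}$$ be the $q$-Hahn weights, and for $0\le p\le k$ put $$a_p^{(k,\ell)}(z)=\binom{k}{p}_{q^2}q^{-2\ell p}\,\frac{(q^{-2\ell};q^2)_{k-p}\,(z;q^2)_p}{(zq^{-2\ell};q^2)_k}.$$ **Theorem.** (1) For all $0\le p\le k$ and all $z\in K$ with $z q^{2j}\neq q^{2\ell}$ for $0\le j<k$, $$a_p^{(k,\ell)}(z)=\binom{k}{p}_{q^2}\frac{\prod_{j=0}^{k-p-1}(q^{2\ell}-q^{2j})\;\prod_{j=0}^{p-1}(1-zq^{2j})}{\prod_{j=0}^{k-1}(q^{2\ell}-zq^{2j})}=\varphi_{\mu,\nu}(p|k)\quad\text{with }\mu=q^{-2\ell},\ \nu=zq^{-2\ell}.$$ (2) For all $u\in K$ such that $R^{\circ(k,\ell)}(u)$ is defined, i.e. $u\neq q^{2m}$ for all integers $m$ with $2-k\le m\le \ell$, $$R^{\circ(k,\ell)}(u)=\sum_{p=0}^{k}a_p^{(k,\ell)}(u)\,\Sigma^{\circ(k,\ell;p)}\quad\text{in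 }H_{k+\ell}(q).$$ -/

import Mathlib

/-!
# The Hecke algebra and its stochastic fused elements
-/

/-- Defining relations of the Hecke algebra `H_n(q)`, on generators `σ_i`, `1 ≤ i < n`. -/
inductive HeckeRel {K : Type*} [Field K] (n : ℕ) (q : K) :
    FreeAlgebra K (Set.Ico 1 n) → FreeAlgebra K (Set.Ico 1 n) → Prop
  | quadratic (i : Set.Ico 1 n) :
      HeckeRel n q (FreeAlgebra.ι K i * FreeAlgebra.ι K i)
        ((q - q⁻¹) • FreeAlgebra.ι K i + 1)
  | braid (i j : Set.Ico 1 n) (h : (j : ℕ) = (i : ℕ) + 1) :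
      HeckeRel n q (FreeAlgebra.ι K i * FreeAlgebra.ι K j * FreeAlgebra.ι K i)
        (FreeAlgebra.ι K j * FreeAlgebra.ι K i * FreeAlgebra.ι K j)
  | comm (i j : Set.Ico 1 n) (h : (i : ℕ) + 1 < (j : ℕ)) :
      HeckeRel n q (FreeAlgebra.ι K i * FreeAlgebra.ι K j)
        (FreeAlgebra.ι K j * FreeAlgebra.ι K i)

/-- The Hecke algebra `H_n(q)` over the field `K`: the unital associative algebra generated by
`σ_1, …, σ_{n-1}` subject to `HeckeRel`. -/
abbrev HeckeAlgebra {K : Type*} [Field K] (n : ℕ) (q : K) : Type _ :=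
  RingQuot (HeckeRel n q)

namespace HeckeAlgebra

variable {K : Type*} [Field K]

/-- The generator `σ_i` of `H_n(q)`, for `1 ≤ i < n` (a dummy value `0` for other `i`). -/
noncomputable def sigma (n : ℕ) (q : K) (i : ℕ) : HeckeAlgebra n q :=
  if h : i ∈ Set.Ico 1 n then
    RingQuot.mkAlgHom K (HeckeRel n q) (FreeAlgebra.ι K (⟨i, h⟩ : Set.Ico 1 n))
  else 0

/-- The stochastic generator `σ°_i = -q σ_i`. -/
noncomputable def stochSigma (n : ℕ) (q : K) (i : ℕ) : HeckeAlgebra n q :=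
  (-q) • sigma n q i

/-- The stochastic R-matrix
`R°_i(u) = (1 - u) / (q² - u) σ°_i + (q² - 1) / (q² - u)`. -/
noncomputable def stochR (n : ℕ) (q : K) (i : ℕ) (u : K) : HeckeAlgebra n q :=
  ((1 - u) / (q ^ 2 - u)) • stochSigma n q i
    + ((q ^ 2 - 1) / (q ^ 2 - u)) • (1 : HeckeAlgebra n q)

/-- The stochastic symmetriser `S°_{[i,j]}`: the product, with `a = i, …, j - 1` increasing from
left to right, of the factors
`R°_a(q^{-2(a-i+1)}) R°_{a-1}(q^{-2(a-i)}) ⋯ R°_i(q^{-2})`. -/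
noncomputable def stochS (n : ℕ) (q : K) (i j : ℕ) : HeckeAlgebra n q :=
  ((List.range' i (j - i)).map fun a =>
    ((List.range' i (a - i + 1)).reverse.map fun b =>
      stochR n q b (q ^ (-2 * ((b : ℤ) - (i : ℤ) + 1)))).prod).prod

/-- `P°^{(k,ℓ)} = S°_{[1,k]} S°_{[k+1,k+ℓ]}`. -/
noncomputable def stochP (n : ℕ) (q : K) (k l : ℕ) : HeckeAlgebra n q :=
  stochS n q 1 k * stochS n q (k + 1) (k + l)

/-- The stochastic fused R-element of `H_{k+ℓ}(q)`:
`R°^{(k,ℓ)}(u) = P°^{(k,ℓ)} ∏_a R°_a(u q^{-2(1-a)}) R°_{a+1}(u q^{-2(2-a)}) ⋯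
R°_{a+ℓ-1}(u q^{-2(ℓ-a)}) P°^{(ℓ,k)}`,
with `a = k, k - 1, …, 1` decreasing from left to right. -/
noncomputable def stochFusedR (q : K) (k l : ℕ) (u : K) : HeckeAlgebra (k + l) q :=
  stochP (k + l) q k l *
    ((List.range' 1 k).reverse.map fun a =>
      ((List.range' 1 l).map fun j =>
        stochR (k + l) q (a + j - 1) (u * q ^ (-2 * ((j : ℤ) - (a : ℤ))))).prod).prod *
    stochP (k + l) q l k

/-- The stochastic partial braiding of `H_{k+ℓ}(q)`, for `0 ≤ p ≤ k ≤ ℓ`: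
`Σ°^{(k,ℓ;p)} = P°^{(k,ℓ)} (σ°_k σ°_{k+1} ⋯ σ°_{ℓ+p-1}) (σ°_{k-1} ⋯ σ°_{ℓ+p-2}) ⋯
(σ°_{k-p+1} ⋯ σ°_ℓ) P°^{(ℓ,k)}`,
with `p` parenthesised factors, each a product of `ℓ + p - k` generators of increasing index. -/
noncomputable def stochPartialBraiding (q : K) (k l p : ℕ) : HeckeAlgebra (k + l) q :=
  stochP (k + l) q k l *
    ((List.range p).map fun r =>
      ((List.range' (k - r) (l + p - k)).map fun b => stochSigma (k + l) q b).prod).prod *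
    stochP (k + l) q l k

end HeckeAlgebra

section QNotation

variable {K : Type*} [Field K]

/-- The deformed integer `[n]_x = (1 - x^n) / (1 - x)`. -/
def qInt (x : K) (n : ℕ) : K := (1 - x ^ n) / (1 - x)

/-- The deformed factorial `[n]_x! = [1]_x ⋯ [n]_x`. -/
def qFact (x : K) (n : ℕ) : K := ∏ j ∈ Finset.Icc 1 n, qInt x j

/-- The deformed binomial coefficient `[n]_x! / ([m]_x! [n-m]_x!)`, for `m ≤ n`. -/
def qBinom (x : K) (n m : ℕ) : K := qFact x n / (qFact x m * qFact x (n - m))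

/-- The q-Pochhammer symbol `(a; x)_n = (1 - a) (1 - a x) ⋯ (1 - a x^{n-1})`. -/
def qPoch (a x : K) (n : ℕ) : K := ∏ j ∈ Finset.range n, (1 - a * x ^ j)

/-- The q-Hahn weight with base `q²` and parameters `μ, ν`, for `p ≤ k`:
`φ(p | k) = binom(k, p)_{q²} μ^p (μ; q²)_{k-p} (ν/μ; q²)_p / (ν; q²)_k`. -/
def qHahn (q μ ν : K) (k p : ℕ) : K :=
  qBinom (q ^ 2) k p * μ ^ p *
    (qPoch μ (q ^ 2) (k - p) * qPoch (ν / μ) (q ^ 2) p / qPoch ν (q ^ 2) k)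

/-- The coefficient, for `p ≤ k`,
`a_p^{(k,ℓ)}(z) =
  binom(k, p)_{q²} q^{-2ℓp} (q^{-2ℓ}; q²)_{k-p} (z; q²)_p / (z q^{-2ℓ}; q²)_k`. -/
def fusedCoeff (q : K) (k l p : ℕ) (z : K) : K :=
  qBinom (q ^ 2) k p * q ^ (-2 * (l : ℤ) * (p : ℤ)) *
    (qPoch (q ^ (-2 * (l : ℤ))) (q ^ 2) (k - p) * qPoch z (q ^ 2) p /
      qPoch (z * q ^ (-2 * (l : ℤ))) (q ^ 2) k)

end QNotation

/-!
Write `Q = q²`. The generators `T_i = σ°_i` satisfy the braid and commutation relations and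
`(T_i - 1) (T_i + Q) = 0`, and `R_i(v)` is normalised so that it acts as `1` wherever `T_i` does.
The symmetrisers are therefore the projections onto the elements fixed by their generators, on
either side (`lInv_qSymm`, `rInv_qSymm`), and the whole argument consists in absorbing generators
into them.

The proof is an induction on `k`, one row `R_{k+1}(v) ⋯ R_{k+l}(v Q^{1-l})`, `v = u Q^k`, at a time.

* Left invariance under `T_1, …, T_{l-1}` travels through the rows already treated and becomes
  invariance under `T_{k+1}, …, T_{k+l-1}` (`lInv_rows`). It rests on a degenerate Yang--Baxter
  equation (`mul_rmat_rmat_mul`), and allows the projector `proj Q T k l` to be inserted to the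
  right of the new row, so that the induction hypothesis applies.
* Between elements invariant on the left and on the right, a row of length `l` collapses to
  `x T_{k+1} ⋯ T_{k+l} + (1 - x)` with `x = (1 - v) / (Q^l - v)` (`mul_ascR_mul`).
* The term `T_{k+1} ⋯ T_{k+l}` turns the `p`-th partial braiding for `k` into the `(p+1)`-st one
  for `k + 1` (`proj_mul_asc_mul`). In the other term the symmetriser on the strands
  `k + 1, …, k + l` is expanded over the coset representatives `T_{k+1} ⋯ T_{k+j}`
  (`cosetSum_qSymm`): the short ones are absorbed and leave the `p`-th partial braiding, the long
  ones give the `(p+1)`-st (`proj_mul_proj_mul_grid`).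

Together the row sends the `p`-th partial braiding to `y` times the `p`-th plus `1 - y` times the
`(p+1)`-st, `y = (Q^l - Q^{k-p}) / (Q^l - v)` (`proj_mul_ascR_mul`), and the coefficients satisfy
the corresponding recursion (`sum_braidingCoeff_succ`), which is the `q`-Pascal rule.
-/

/-! ### Families satisfying the stochastic Hecke relations -/

/-- A family `T_1, …, T_{n-1}` in a `K`-algebra with the braid and commutation relations and the
quadratic relation `(T_i - 1) (T_i + Q) = 0`. The generators `σ°_i` of `H_n(q)` are such a family
for `Q = q²`, and so is the same family in the opposite algebra. -/
structure IsHeckeFamily {K A : Type*} [Field K] [Ring A] [Algebra K A] (n : ℕ) (Q : K)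
    (T : ℕ → A) : Prop where
  quadratic : ∀ i, 1 ≤ i → i < n → T i * T i = (1 - Q) • T i + Q • (1 : A)
  braid : ∀ i, 1 ≤ i → i + 1 < n → T i * T (i + 1) * T i = T (i + 1) * T i * T (i + 1)
  comm : ∀ i j, 1 ≤ i → i + 1 < j → j < n → Commute (T i) (T j)

namespace IsHeckeFamily

open MulOpposite

variable {K A : Type*} [Field K] [Ring A] [Algebra K A]

/-- `X` is fixed by left multiplication by `T_i, …, T_{i+m-1}`. -/
def LInv (T : ℕ → A) (i m : ℕ) (X : A) : Prop := ∀ a, i ≤ a → a < i + m → T a * X = X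

/-- `X` is fixed by right multiplication by `T_i, …, T_{i+m-1}`. -/
def RInv (T : ℕ → A) (i m : ℕ) (X : A) : Prop := ∀ a, i ≤ a → a < i + m → X * T a = X

/-- The ascending product `T_i T_{i+1} ⋯ T_{i+m-1}`. -/
def asc (T : ℕ → A) (i m : ℕ) : A := ((List.range m).map fun j => T (i + j)).prod

/-- The R-matrix `((1 - v) T_i + (Q - 1)) / (Q - v)`, normalised to be `1` where `T_i` is. -/
def rmat (Q : K) (T : ℕ → A) (i : ℕ) (v : K) : A :=
  ((1 - v) / (Q - v)) • T i + ((Q - 1) / (Q - v)) • (1 : A)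

/-- The row `R_i(v) R_{i+1}(v Q⁻¹) ⋯ R_{i+m-1}(v Q^{-(m-1)})` of R-matrices. -/
def ascR (Q : K) (T : ℕ → A) (i m : ℕ) (v : K) : A :=
  ((List.range m).map fun j => rmat Q T (i + j) (v * (Q ^ j)⁻¹)).prod

/-- The symmetriser for the `m` generators `T_i, …, T_{i+m-1}`, built from rows of R-matrices
multiplied from the left. -/
def qSymm (Q : K) (T : ℕ → A) (i : ℕ) : ℕ → A
  | 0 => 1
  | m + 1 => ascR Q T i (m + 1) Q⁻¹ * qSymm Q T i m

theorem asc_zero (T : ℕ → A) (i : ℕ) : asc T i 0 = 1 := by simp [asc]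

theorem asc_succ (T : ℕ → A) (i m : ℕ) : asc T i (m + 1) = asc T i m * T (i + m) := by
  simp [asc, List.prod_range_succ]

theorem asc_succ' (T : ℕ → A) (i m : ℕ) : asc T i (m + 1) = T i * asc T (i + 1) m := by
  rw [asc, List.prod_range_succ']
  simp [asc, add_assoc, add_comm 1]

theorem asc_add (T : ℕ → A) (i m m' : ℕ) :
    asc T i (m + m') = asc T i m * asc T (i + m) m' := by
  induction m' with
  | zero => simp [asc_zero]
  | succ m' ih => rw [← add_assoc, asc_succ, ih, asc_succ, mul_assoc, add_assoc]

theorem ascR_zero (Q : K) (T : ℕ → A) (i : ℕ) (v : K) : ascR Q T i 0 v = 1 := by simp [ascR]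

theorem ascR_succ (Q : K) (T : ℕ → A) (i m : ℕ) (v : K) :
    ascR Q T i (m + 1) v = ascR Q T i m v * rmat Q T (i + m) (v * (Q ^ m)⁻¹) := by
  simp [ascR, List.prod_range_succ]

theorem ascR_succ' (Q : K) (T : ℕ → A) (i m : ℕ) (v : K) :
    ascR Q T i (m + 1) v = rmat Q T i v * ascR Q T (i + 1) m (v * Q⁻¹) := by
  rw [ascR, List.prod_range_succ']
  simp [ascR, add_assoc, add_comm 1, pow_succ, mul_assoc]

theorem commute_asc {T : ℕ → A} {i m : ℕ} {X : A}
    (h : ∀ a, i ≤ a → a < i + m → Commute X (T a)) : Commute X (asc T i m) := by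
  refine Commute.list_prod_right _ _ fun x hx => ?_
  obtain ⟨j, hj, rfl⟩ := List.mem_map.1 hx
  have := List.mem_range.1 hj
  exact h _ (by omega) (by omega)

/-! ### Intertwiners and invariant elements -/

theorem semiconj_rmat {T : ℕ → A} {i j : ℕ} {X : A} (Q v : K)
    (h : SemiconjBy X (T i) (T j)) : SemiconjBy X (rmat Q T i v) (rmat Q T j v) := by
  have h' : X * T i = T j * X := h
  simp only [SemiconjBy, rmat, mul_add, add_mul, mul_smul_comm, smul_mul_assoc, mul_one, one_mul,
    h']

theorem semiconj_ascR {T : ℕ → A} {i j m : ℕ} {X : A} (Q v : K)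
    (h : ∀ r, r < m → SemiconjBy X (T (i + r)) (T (j + r))) :
    SemiconjBy X (ascR Q T i m v) (ascR Q T j m v) := by
  induction m with
  | zero => simp [ascR_zero]
  | succ m ih =>
    rw [ascR_succ, ascR_succ]
    exact (ih fun r hr => h r (by omega)).mul_right (semiconj_rmat _ _ (h m (by omega)))

/-- The parameters in the symmetriser depend only on relative positions, so an element that shifts
the generators also shifts the symmetriser. -/
theorem semiconj_qSymm {T : ℕ → A} {i j m : ℕ} {X : A} (Q : K)
    (h : ∀ r, r < m → SemiconjBy X (T (i + r)) (T (j + r))) :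
    SemiconjBy X (qSymm Q T i m) (qSymm Q T j m) := by
  induction m with
  | zero => simp [qSymm]
  | succ m ih =>
    exact (semiconj_ascR _ _ h).mul_right (ih fun r hr => h r (by omega))

theorem commute_ascR {T : ℕ → A} {i m : ℕ} {X : A} (Q v : K)
    (h : ∀ a, i ≤ a → a < i + m → Commute X (T a)) : Commute X (ascR Q T i m v) :=
  semiconj_ascR Q v fun r hr => h (i + r) (by omega) (by omega)

theorem commute_qSymm {T : ℕ → A} {i m : ℕ} {X : A} (Q : K)
    (h : ∀ a, i ≤ a → a < i + m → Commute X (T a)) : Commute X (qSymm Q T i m) :=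
  semiconj_qSymm Q fun r hr => h (i + r) (by omega) (by omega)

theorem LInv.asc_mul {T : ℕ → A} {i m : ℕ} {X : A} (h : LInv T i m X) : asc T i m * X = X := by
  induction m with
  | zero => simp [asc_zero]
  | succ m ih =>
    rw [asc_succ, mul_assoc, h (i + m) (by omega) (by omega)]
    exact ih fun a h1 h2 => h a h1 (by omega)

theorem LInv.mul_of_commute {T : ℕ → A} {i m : ℕ} {X Y : A} (h : LInv T i m X)
    (hY : ∀ a, i ≤ a → a < i + m → Commute (T a) Y) : LInv T i m (Y * X) := fun a h1 h2 => by
  rw [← mul_assoc, (hY a h1 h2).eq, mul_assoc, h a h1 h2]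

theorem LInv.mul_right {T : ℕ → A} {i m : ℕ} {X : A} (h : LInv T i m X) (Y : A) :
    LInv T i m (X * Y) := fun a h1 h2 => by rw [← mul_assoc, h a h1 h2]

theorem RInv.mul_left {T : ℕ → A} {i m : ℕ} {X : A} (h : RInv T i m X) (Y : A) :
    RInv T i m (Y * X) := fun a h1 h2 => by rw [mul_assoc, h a h1 h2]

theorem RInv.mul_of_commute {T : ℕ → A} {i m : ℕ} {X Y : A} (h : RInv T i m X)
    (hY : ∀ a, i ≤ a → a < i + m → Commute (T a) Y) : RInv T i m (X * Y) := fun a h1 h2 => by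
  rw [mul_assoc, ← (hY a h1 h2).eq, ← mul_assoc, h a h1 h2]

theorem LInv.mono {T : ℕ → A} {i m i' m' : ℕ} {X : A} (h : LInv T i m X)
    (h1 : i ≤ i') (h2 : i' + m' ≤ i + m) : LInv T i' m' X :=
  fun a ha hb => h a (by omega) (by omega)

theorem RInv.mono {T : ℕ → A} {i m i' m' : ℕ} {X : A} (h : RInv T i m X)
    (h1 : i ≤ i') (h2 : i' + m' ≤ i + m) : RInv T i' m' X :=
  fun a ha hb => h a (by omega) (by omega)

theorem rmat_weights {Q v : K} (hv : v ≠ Q) : (1 - v) / (Q - v) + (Q - 1) / (Q - v) = 1 := by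
  have : Q - v ≠ 0 := sub_ne_zero.2 hv.symm
  field_simp
  ring

theorem rmat_mul {Q v : K} {T : ℕ → A} {i : ℕ} {X : A} (hv : v ≠ Q) (h : T i * X = X) :
    rmat Q T i v * X = X := by
  rw [rmat, add_mul, smul_mul_assoc, smul_mul_assoc, h, one_mul, ← add_smul, rmat_weights hv,
    one_smul]

theorem mul_rmat {Q v : K} {T : ℕ → A} {i : ℕ} {X : A} (hv : v ≠ Q) (h : X * T i = X) :
    X * rmat Q T i v = X := by
  rw [rmat, mul_add, mul_smul_comm, mul_smul_comm, h, mul_one, ← add_smul, rmat_weights hv,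
    one_smul]

theorem LInv.ascR_mul {Q v : K} {T : ℕ → A} {i m : ℕ} {X : A} (h : LInv T i m X)
    (hv : ∀ j, j < m → v * (Q ^ j)⁻¹ ≠ Q) : ascR Q T i m v * X = X := by
  induction m with
  | zero => simp [ascR_zero]
  | succ m ih =>
    rw [ascR_succ, mul_assoc, rmat_mul (hv m (by omega)) (h (i + m) (by omega) (by omega))]
    exact ih (h.mono le_rfl (by omega)) fun j hj => hv j (by omega)

theorem RInv.mul_ascR {Q v : K} {T : ℕ → A} {i m : ℕ} {X : A} (h : RInv T i m X)
    (hv : ∀ j, j < m → v * (Q ^ j)⁻¹ ≠ Q) : X * ascR Q T i m v = X := by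
  induction m with
  | zero => simp [ascR_zero]
  | succ m ih =>
    rw [ascR_succ, ← mul_assoc, ih (h.mono le_rfl (by omega)) fun j hj => hv j (by omega),
      mul_rmat (hv m (by omega)) (h (i + m) (by omega) (by omega))]

theorem inv_mul_inv_pow_ne {Q : K} (hQ0 : Q ≠ 0) {j : ℕ} (h : Q ^ (j + 2) ≠ 1) :
    Q⁻¹ * (Q ^ j)⁻¹ ≠ Q := by
  intro h'
  apply h
  rw [← mul_inv, inv_eq_iff_eq_inv] at h'
  rw [pow_add, sq, ← mul_assoc, mul_comm (Q ^ j), h', inv_mul_cancel₀ hQ0]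

theorem LInv.qSymm_mul {Q : K} {T : ℕ → A} {i m : ℕ} {X : A} (h : LInv T i m X) (hQ0 : Q ≠ 0)
    (hQ : ∀ j, 1 ≤ j → j ≤ m + 1 → Q ^ j ≠ 1) : qSymm Q T i m * X = X := by
  induction m with
  | zero => simp [qSymm]
  | succ m ih =>
    rw [qSymm, mul_assoc, ih (h.mono le_rfl (by omega)) fun j h1 h2 => hQ j h1 (by omega)]
    exact h.ascR_mul fun j hj => inv_mul_inv_pow_ne hQ0 (hQ _ (by omega) (by omega))

theorem RInv.mul_qSymm {Q : K} {T : ℕ → A} {i m : ℕ} {X : A} (h : RInv T i m X) (hQ0 : Q ≠ 0)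
    (hQ : ∀ j, 1 ≤ j → j ≤ m + 1 → Q ^ j ≠ 1) : X * qSymm Q T i m = X := by
  induction m with
  | zero => simp [qSymm]
  | succ m ih =>
    rw [qSymm, ← mul_assoc, h.mul_ascR fun j hj =>
      inv_mul_inv_pow_ne hQ0 (hQ _ (by omega) (by omega))]
    exact ih (h.mono le_rfl (by omega)) fun j h1 h2 => hQ j h1 (by omega)

/-! ### The symmetriser is two-sided invariant -/

variable {n : ℕ} {Q : K} {T : ℕ → A}

theorem comm' (hT : IsHeckeFamily n Q T) {i j : ℕ} (hi : 1 ≤ i) (hj : 1 ≤ j) (hin : i < n)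
    (hjn : j < n) (h : i + 1 < j ∨ j + 1 < i) : Commute (T i) (T j) :=
  h.elim (fun h => hT.comm i j hi h hjn) fun h => (hT.comm j i hj h hin).symm

/-- Invariance under `T_i` turns into invariance under `T_{i+1}` across `R_i(v) R_{i+1}(v Q⁻¹)`;
this is the Yang--Baxter equation at the point where the third R-matrix degenerates to a multiple
of `T - 1`. -/
theorem mul_rmat_rmat_mul (hT : IsHeckeFamily n Q T) (hQ0 : Q ≠ 0) {i : ℕ} (hi : 1 ≤ i)
    (hin : i + 1 < n) (v : K) {X : A} (hX : T i * X = X) :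
    T (i + 1) * (rmat Q T i v * (rmat Q T (i + 1) (v * Q⁻¹) * X)) =
      rmat Q T i v * (rmat Q T (i + 1) (v * Q⁻¹) * X) := by
  have hb : T (i + 1) * (T i * (T (i + 1) * X)) = T i * (T (i + 1) * X) := by
    have := congrArg (· * X) (hT.braid i hi hin)
    simp only [mul_assoc, hX] at this
    exact this.symm
  have hq : T (i + 1) * (T (i + 1) * X) = (1 - Q) • (T (i + 1) * X) + Q • X := by
    rw [← mul_assoc, hT.quadratic _ (by omega) hin, add_mul, smul_mul_assoc, smul_mul_assoc,
      one_mul]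
  have hv : 1 - v * Q⁻¹ = Q⁻¹ * (Q - v) := by field_simp
  have e1 : rmat Q T i v = (Q - v)⁻¹ • ((1 - v) • T i + (Q - 1) • (1 : A)) := by
    rw [rmat, smul_add, smul_smul, smul_smul, div_eq_inv_mul, div_eq_inv_mul]
  have e2 : rmat Q T (i + 1) (v * Q⁻¹) =
      ((Q - v * Q⁻¹)⁻¹ * Q⁻¹) • ((Q - v) • T (i + 1) + (Q * (Q - 1)) • (1 : A)) := by
    rw [rmat, smul_add, smul_smul, smul_smul, div_eq_inv_mul, div_eq_inv_mul, hv]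
    congr 2
    · ring
    · field_simp
  rw [e1, e2]
  simp only [smul_mul_assoc, mul_smul_comm, add_mul, mul_add, one_mul, hb, hq, hX, smul_add]
  module

/-- A row of R-matrices shifts left invariance by one strand. -/
theorem LInv.ascR_shift (hT : IsHeckeFamily n Q T) (hQ0 : Q ≠ 0) {i m : ℕ} (hi : 1 ≤ i)
    (hin : i + m < n) (v : K) {X : A} (hX : LInv T i m X) :
    LInv T (i + 1) m (ascR Q T i (m + 1) v * X) := by
  induction m generalizing i v X with
  | zero => exact fun a h1 h2 => by omega
  | succ m ih =>
    intro a h1 h2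
    rw [ascR_succ', mul_assoc]
    rcases h1.eq_or_lt with rfl | h1
    · rw [ascR_succ', mul_assoc]
      refine mul_rmat_rmat_mul hT hQ0 hi (by omega) v ?_
      have : Commute (T i) (ascR Q T (i + 1 + 1) m (v * Q⁻¹ * Q⁻¹)) :=
        commute_ascR _ _ fun b h3 h4 => hT.comm _ _ hi (by omega) (by omega)
      rw [← mul_assoc, this.eq, mul_assoc, hX i le_rfl (by omega)]
    · have : Commute (T a) (rmat Q T i v) :=
        semiconj_rmat Q v (hT.comm' (by omega) hi (by omega) (by omega) (Or.inr (by omega)))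
      rw [← mul_assoc, this.eq, mul_assoc,
        ih (by omega) (by omega) (v * Q⁻¹) (hX.mono (by omega) (by omega)) a (by omega) (by omega)]

/-- At `v = Q⁻¹` the R-matrix is a multiple of `T_i + Q`, which `T_i - 1` annihilates. -/
theorem mul_rmat_inv (hT : IsHeckeFamily n Q T) (hQ0 : Q ≠ 0) {i : ℕ} (hi : 1 ≤ i)
    (hin : i < n) : T i * rmat Q T i Q⁻¹ = rmat Q T i Q⁻¹ := by
  have hv : 1 - Q⁻¹ = Q⁻¹ * (Q - 1) := by field_simp
  rw [rmat, mul_add, mul_smul_comm, mul_smul_comm, hT.quadratic i hi hin, mul_one, hv]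
  match_scalars <;> (field_simp; try ring)

theorem lInv_qSymm (hT : IsHeckeFamily n Q T) (hQ0 : Q ≠ 0) {i m : ℕ} (hi : 1 ≤ i)
    (hin : i + m ≤ n) : LInv T i m (qSymm Q T i m) := by
  induction m with
  | zero => exact fun a h1 h2 => by omega
  | succ m ih =>
    intro a h1 h2
    rcases h1.eq_or_lt with rfl | h1
    · rw [qSymm, ascR_succ', mul_assoc, ← mul_assoc, mul_rmat_inv hT hQ0 hi (by omega)]
    · exact LInv.ascR_shift hT hQ0 hi (by omega) _ (ih (by omega)) a h1 (by omega)

/-- The relations are symmetric under reversal of words. -/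
theorem op (hT : IsHeckeFamily n Q T) : IsHeckeFamily n Q fun i => op (T i) where
  quadratic i h1 h2 := by
    rw [← op_mul, hT.quadratic i h1 h2]
    rfl
  braid i h1 h2 := by
    rw [← op_mul, ← op_mul, ← op_mul, ← op_mul, ← mul_assoc, ← mul_assoc, hT.braid i h1 h2]
  comm i j h1 h2 h3 := (hT.comm i j h1 h2 h3).op

theorem rInv_unop_qSymm (hT : IsHeckeFamily n Q T) (hQ0 : Q ≠ 0) {i m : ℕ} (hi : 1 ≤ i)
    (hin : i + m ≤ n) : RInv T i m (unop (qSymm Q (fun i => MulOpposite.op (T i)) i m)) :=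
  fun a h1 h2 => congrArg unop (lInv_qSymm hT.op hQ0 hi hin a h1 h2)

/-- The left invariant symmetriser equals its mirror image, which is right invariant: the product
of the mirror image with the symmetriser is equal to both. -/
theorem unop_qSymm (hT : IsHeckeFamily n Q T) (hQ0 : Q ≠ 0) {i m : ℕ} (hi : 1 ≤ i)
    (hin : i + m ≤ n) (hQ : ∀ j, 1 ≤ j → j ≤ m + 1 → Q ^ j ≠ 1) :
    unop (qSymm Q (fun i => MulOpposite.op (T i)) i m) = qSymm Q T i m := by
  rw [← (rInv_unop_qSymm hT hQ0 hi hin).mul_qSymm hQ0 hQ]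
  apply op_injective
  rw [op_mul, op_unop]
  refine RInv.mul_qSymm (fun a h1 h2 => ?_) hQ0 hQ
  rw [← op_mul, lInv_qSymm hT hQ0 hi hin a h1 h2]

theorem rInv_qSymm (hT : IsHeckeFamily n Q T) (hQ0 : Q ≠ 0) {i m : ℕ} (hi : 1 ≤ i)
    (hin : i + m ≤ n) (hQ : ∀ j, 1 ≤ j → j ≤ m + 1 → Q ^ j ≠ 1) : RInv T i m (qSymm Q T i m) := by
  rw [← unop_qSymm hT hQ0 hi hin hQ]
  exact rInv_unop_qSymm hT hQ0 hi hin

/-! ### Expansion of the symmetriser over cosets -/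

/-- Moving a generator across an ascending product raises its index by one. -/
theorem semiconj_asc (hT : IsHeckeFamily n Q T) {i m a : ℕ} (hi : 1 ≤ i) (hin : i + m ≤ n)
    (h1 : i ≤ a) (h2 : a + 1 < i + m) : SemiconjBy (asc T i m) (T a) (T (a + 1)) := by
  induction m generalizing i with
  | zero => omega
  | succ m ih =>
    rw [asc_succ']
    rcases h1.eq_or_lt with rfl | h1
    · obtain ⟨m, rfl⟩ : ∃ m', m = m' + 1 := ⟨m - 1, by omega⟩
      have hc : Commute (T i) (asc T (i + 1 + 1) m) :=
        commute_asc fun b h3 h4 => hT.comm _ _ hi (by omega) (by omega)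
      rw [asc_succ', SemiconjBy, ← mul_assoc, mul_assoc, ← hc.eq, ← mul_assoc, ← mul_assoc,
        ← mul_assoc, hT.braid i hi (by omega)]
    · exact SemiconjBy.mul_left (hT.comm' hi (by omega) (by omega) (by omega)
        (Or.inl (by omega))) (ih (by omega) (by omega) (by omega) (by omega))

/-- Right invariance under `T_{i+1}, …, T_{i+m-1}` extends to `T_i` after multiplication by the sum
over the minimal coset representatives `T_i ⋯ T_{i+j-1}`, `0 ≤ j ≤ m`, weighted by `Q^{-j}`. -/
theorem RInv.mul_cosetSum (hT : IsHeckeFamily n Q T) (hQ0 : Q ≠ 0) {i m : ℕ} (hi : 1 ≤ i)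
    (hin : i + m ≤ n) {E : A} (hE : RInv T (i + 1) (m - 1) E) :
    RInv T i m (E * ∑ j ∈ Finset.range (m + 1), (Q ^ j)⁻¹ • asc T i j) := by
  induction m with
  | zero => exact fun a h1 h2 => by omega
  | succ m ih =>
    intro a h1 h2
    by_cases ha : a < i + m
    · have hs : asc T i (m + 1) * T a = T (a + 1) * asc T i (m + 1) :=
        semiconj_asc hT hi (by omega) h1 (by omega)
      rw [Finset.sum_range_succ, mul_add, add_mul,
        ih (by omega) (hE.mono (by omega) (by omega)) a h1 ha, mul_smul_comm, smul_mul_assoc,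
        mul_assoc, hs, ← mul_assoc, hE _ (by omega) (by omega)]
    · obtain rfl : a = i + m := by omega
      have hs : E * (∑ j ∈ Finset.range m, (Q ^ j)⁻¹ • asc T i j) * T (i + m) =
          E * ∑ j ∈ Finset.range m, (Q ^ j)⁻¹ • asc T i j := by
        rw [Finset.mul_sum, Finset.sum_mul]
        refine Finset.sum_congr rfl fun j hj => ?_
        have := Finset.mem_range.1 hj
        have hc : Commute (T (i + m)) (asc T i j) := commute_asc fun b h3 h4 =>
          hT.comm' (by omega) (by omega) (by omega) (by omega) (Or.inr (by omega))
        rw [mul_smul_comm, smul_mul_assoc, mul_assoc, ← hc.eq, ← mul_assoc,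
          hE _ (by omega) (by omega)]
      rw [Finset.sum_range_succ, Finset.sum_range_succ, add_assoc, mul_add, add_mul, hs, asc_succ]
      congr 1
      simp only [mul_add, add_mul, mul_smul_comm, smul_mul_assoc, mul_assoc,
        hT.quadratic (i + m) (by omega) (by omega), mul_one, smul_add]
      match_scalars <;> (field_simp; try ring)

/-- The symmetriser on `m + 1` strands is proportional to the symmetriser on the last `m` strands
times the sum over cosets, since both sides are right invariant and have the same product with the
symmetriser. -/
theorem cosetSum_qSymm (hT : IsHeckeFamily n Q T) (hQ0 : Q ≠ 0) {i m : ℕ} (hi : 1 ≤ i)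
    (hin : i + m ≤ n) (hQ : ∀ j, 1 ≤ j → j ≤ m + 1 → Q ^ j ≠ 1) :
    qSymm Q T (i + 1) (m - 1) * ∑ j ∈ Finset.range (m + 1), (Q ^ j)⁻¹ • asc T i j =
      (∑ j ∈ Finset.range (m + 1), (Q ^ j)⁻¹) • qSymm Q T i m := by
  rcases Nat.eq_zero_or_pos m with rfl | hm
  · simp [qSymm, asc_zero]
  have hL := lInv_qSymm hT hQ0 hi hin
  rw [← (RInv.mul_cosetSum hT hQ0 hi hin (rInv_qSymm hT hQ0 (by omega) (by omega)
    fun j h1 h2 => hQ j h1 (by omega))).mul_qSymm hQ0 hQ, mul_assoc, Finset.sum_mul]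
  rw [Finset.sum_congr rfl fun j hj => (show (Q ^ j)⁻¹ • asc T i j * qSymm Q T i m =
      (Q ^ j)⁻¹ • qSymm Q T i m by
    have := Finset.mem_range.1 hj
    rw [smul_mul_assoc, (hL.mono le_rfl (by omega)).asc_mul])]
  rw [← Finset.sum_smul, mul_smul_comm, (hL.mono (by omega) (by omega)).qSymm_mul hQ0
    fun j h1 h2 => hQ j h1 (by omega)]

/-! ### Expansion of a row of R-matrices -/

/-- The product of the weights of the generators in a row of length `m`. It telescopes to
`(1 - v) / (Q^m - v)`. -/
def rowWeight (Q v : K) (m : ℕ) : K :=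
  ∏ j ∈ Finset.range m, (1 - v * (Q ^ j)⁻¹) / (Q - v * (Q ^ j)⁻¹)

theorem mul_rowWeight (hQ0 : Q ≠ 0) {v : K} {m : ℕ} (hv : ∀ j, j < m → v * (Q ^ j)⁻¹ ≠ Q) :
    (Q ^ m - v) * rowWeight Q v m = 1 - v := by
  induction m with
  | zero => simp [rowWeight]
  | succ m ih =>
    have h : Q - v * (Q ^ m)⁻¹ ≠ 0 := sub_ne_zero.2 (hv m (by omega)).symm
    rw [← ih fun j hj => hv j (by omega), rowWeight, rowWeight, Finset.prod_range_succ]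
    have e : Q ^ (m + 1) - v = Q ^ m * (Q - v * (Q ^ m)⁻¹) := by
      field_simp
      ring
    have e' : Q ^ m - v = Q ^ m * (1 - v * (Q ^ m)⁻¹) := by field_simp
    rw [e, e', ← mul_div_assoc, ← mul_div_assoc, div_eq_iff h]
    ring

/-- Between invariant elements only two terms of the expanded row survive: the term with every
generator, and all others, in which the last unit factor lets the generators on its right be
absorbed by `E` and the R-matrices on its left by `Y`. -/
theorem mul_ascR_mul (hT : IsHeckeFamily n Q T) {i m : ℕ} (hi : 1 ≤ i) (hin : i + m ≤ n) {v : K}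
    (hv : ∀ j, j < m → v * (Q ^ j)⁻¹ ≠ Q) {E Y : A} (hE : RInv T (i + 1) (m - 1) E)
    (hY : LInv T i (m - 1) Y) :
    E * ascR Q T i m v * Y =
      rowWeight Q v m • (E * asc T i m * Y) + (1 - rowWeight Q v m) • (E * Y) := by
  induction m generalizing Y with
  | zero => simp [rowWeight, ascR_zero, asc_zero]
  | succ m ih =>
    have hE' : RInv T (i + 1) (m - 1) E := hE.mono le_rfl (by omega)
    have h1 := ih (Y := Y) (by omega) (fun j hj => hv j (by omega)) hE'
      (hY.mono le_rfl (by omega))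
    have h2 := ih (Y := T (i + m) * Y) (by omega) (fun j hj => hv j (by omega)) hE'
      (LInv.mul_of_commute (hY.mono le_rfl (by omega)) fun a h3 h4 =>
        hT.comm _ _ (by omega) (by omega) (by omega))
    -- for `m = 0` the generator `T_i` is not absorbed by `E`, but then its weight vanishes
    have hEY : (1 - rowWeight Q v m) • (E * (T (i + m) * Y)) =
        (1 - rowWeight Q v m) • (E * Y) := by
      rcases Nat.eq_zero_or_pos m with rfl | hm
      · simp [rowWeight]
      · rw [← mul_assoc, hE _ (by omega) (by omega)]
    rw [mul_assoc E (asc T i m), LInv.asc_mul (hY.mono le_rfl (by omega)), ← add_smul,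
      add_sub_cancel, one_smul] at h1
    rw [hEY] at h2
    have hw : rowWeight Q v (m + 1) = rowWeight Q v m *
        ((1 - v * (Q ^ m)⁻¹) / (Q - v * (Q ^ m)⁻¹)) := Finset.prod_range_succ _ _
    have hab := rmat_weights (hv m (by omega))
    rw [hw, ascR_succ, asc_succ, rmat, eq_sub_of_add_eq' hab]
    generalize (1 - v * (Q ^ m)⁻¹) / (Q - v * (Q ^ m)⁻¹) = α
    simp only [mul_add, add_mul, mul_smul_comm, smul_mul_assoc, mul_one]
    rw [h1, ← mul_assoc E, ← mul_assoc E, mul_assoc _ (T (i + m)) Y, mul_assoc _ (T (i + m)) Y, h2]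
    module

/-! ### Partial braidings -/

/-- The product of `p` ascending products of length `m`, started at `i, i - 1, …, i - p + 1`; it
braids a block of `p` strands past a block of `m` strands. -/
def grid (T : ℕ → A) (i m p : ℕ) : A := ((List.range p).map fun r => asc T (i - r) m).prod

/-- The product of the symmetrisers on the first `a` and on the following `b` strands. -/
def proj (Q : K) (T : ℕ → A) (a b : ℕ) : A := qSymm Q T 1 (a - 1) * qSymm Q T (a + 1) (b - 1)

theorem grid_zero (T : ℕ → A) (i m : ℕ) : grid T i m 0 = 1 := by simp [grid]

theorem grid_succ (T : ℕ → A) (i m p : ℕ) :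
    grid T i m (p + 1) = asc T i m * grid T (i - 1) m p := by
  rw [grid, List.prod_range_succ']
  simp [grid, Nat.sub_sub, add_comm 1]

theorem commute_grid {i m p : ℕ} {X : A}
    (h : ∀ a, i + 1 ≤ a + p → a < i + m → Commute X (T a)) : Commute X (grid T i m p) := by
  refine Commute.list_prod_right _ _ fun x hx => ?_
  obtain ⟨j, hj, rfl⟩ := List.mem_map.1 hx
  have := List.mem_range.1 hj
  exact commute_asc fun a h1 h2 => h _ (by omega) (by omega)

/-- Moving a generator of the braided block of `m` strands across the grid shifts it by `p`. -/
theorem semiconj_grid (hT : IsHeckeFamily n Q T) {i m p a : ℕ} (hp : p ≤ i) (hin : i + m ≤ n)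
    (h1 : i < a + p) (h2 : a + p < i + m) : SemiconjBy (grid T i m p) (T a) (T (a + p)) := by
  induction p generalizing i with
  | zero => simp [grid_zero]
  | succ p ih =>
    rw [grid_succ]
    exact SemiconjBy.mul_left
      (semiconj_asc hT (a := a + p) (by omega) hin (by omega) (by omega))
      (ih (by omega) (by omega) (by omega) (by omega))

theorem LInv.grid_mul (hT : IsHeckeFamily n Q T) {i m p : ℕ} (hp : p ≤ i) (hin : i + m ≤ n)
    {X : A} (hX : LInv T (i + 1 - p) (m - 1) X) :
    LInv T (i + 1) (m - 1) (grid T i m p * X) := by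
  intro a h1 h2
  obtain ⟨b, rfl⟩ : ∃ b, a = b + p := ⟨a - p, by omega⟩
  have h : grid T i m p * T b = T (b + p) * grid T i m p :=
    semiconj_grid hT hp hin (by omega) (by omega)
  rw [← mul_assoc, ← h, mul_assoc, hX b (by omega) (by omega)]

/-- The first generators of the ascending products form a descending product that can be pulled
out on the left and absorbed. -/
theorem RInv.mul_grid (hT : IsHeckeFamily n Q T) {i m p : ℕ} (hp : p ≤ i)
    (hin : i + m < n) {E : A} (hE : RInv T (i + 1 - p) p E) :
    E * grid T i (m + 1) p = E * grid T (i + 1) m p := by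
  induction p generalizing i E with
  | zero => simp [grid_zero]
  | succ p ih =>
    have hE' : RInv T (i - 1 + 1 - p) p (E * asc T (i + 1) m) :=
      (hE.mono (by omega) (by omega)).mul_of_commute fun a h1 h2 => commute_asc fun b h3 h4 =>
        hT.comm _ _ (by omega) (by omega) (by omega)
    rw [grid_succ, asc_succ', ← mul_assoc, ← mul_assoc, hE i (by omega) (by omega),
      ih (by omega) (by omega) hE', grid_succ, mul_assoc, Nat.sub_add_cancel (by omega),
      Nat.add_sub_cancel]

section proj

variable (hT : IsHeckeFamily n Q T) (hQ0 : Q ≠ 0) {a b : ℕ} (hab : a + b ≤ n)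

include hT hQ0 hab

omit hQ0 in
theorem commute_qSymm_qSymm : Commute (qSymm Q T 1 (a - 1)) (qSymm Q T (a + 1) (b - 1)) :=
  commute_qSymm _ fun c h1 h2 => (commute_qSymm _ fun d h3 h4 =>
    hT.comm' (by omega) (by omega) (by omega) (by omega) (Or.inr (by omega))).symm

theorem lInv_proj_fst : LInv T 1 (a - 1) (proj Q T a b) := by
  rcases Nat.eq_zero_or_pos a with rfl | ha
  · exact fun c h1 h2 => by omega
  · exact (lInv_qSymm hT hQ0 le_rfl (by omega)).mul_right _

theorem lInv_proj_snd : LInv T (a + 1) (b - 1) (proj Q T a b) := by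
  rcases Nat.eq_zero_or_pos b with rfl | hb
  · exact fun c h1 h2 => by omega
  · rw [proj, (commute_qSymm_qSymm hT hab).eq]
    exact (lInv_qSymm hT hQ0 (by omega) (by omega)).mul_right _

variable (hQ : ∀ j, 1 ≤ j → j ≤ max a b → Q ^ j ≠ 1)

include hQ

theorem rInv_proj_fst : RInv T 1 (a - 1) (proj Q T a b) := by
  rcases Nat.eq_zero_or_pos a with rfl | ha
  · exact fun c h1 h2 => by omega
  · rw [proj, (commute_qSymm_qSymm hT hab).eq]
    exact (rInv_qSymm hT hQ0 le_rfl (by omega) fun j h1 h2 => hQ j h1 (by omega)).mul_left _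

theorem rInv_proj_snd : RInv T (a + 1) (b - 1) (proj Q T a b) := by
  rcases Nat.eq_zero_or_pos b with rfl | hb
  · exact fun c h1 h2 => by omega
  · exact (rInv_qSymm hT hQ0 (by omega) (by omega) fun j h1 h2 => hQ j h1 (by omega)).mul_left _

end proj

/-! ### Adding one strand -/

/-- The product of the rows of R-matrices started at `k, k - 1, …, 1`. -/
def rows (Q : K) (T : ℕ → A) (l : ℕ) (u : K) : ℕ → A
  | 0 => 1
  | k + 1 => ascR Q T (k + 1) l (u * Q ^ k) * rows Q T l u k

/-- Each row of R-matrices shifts the left invariance by one strand. -/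
theorem lInv_rows (hT : IsHeckeFamily n Q T) (hQ0 : Q ≠ 0) {k l : ℕ} (hkl : k + l ≤ n) (u : K)
    {Y : A} (hY : LInv T 1 (l - 1) Y) : LInv T (k + 1) (l - 1) (rows Q T l u k * Y) := by
  rcases Nat.eq_zero_or_pos l with rfl | hl
  · exact fun a h1 h2 => by omega
  induction k with
  | zero => simpa [rows] using hY
  | succ k ih =>
    obtain ⟨l, rfl⟩ : ∃ l', l = l' + 1 := ⟨l - 1, by omega⟩
    rw [rows, mul_assoc]
    exact LInv.ascR_shift hT hQ0 (by omega) (by omega) _ (ih (by omega))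

/-- The partial braiding that exchanges `p` strands with `l + p - k`, between the symmetrisers. -/
def partialBraiding (Q : K) (T : ℕ → A) (k l p : ℕ) : A :=
  proj Q T k l * grid T k (l + p - k) p * proj Q T l k

section step

variable (hT : IsHeckeFamily n Q T) (hQ0 : Q ≠ 0) {k l : ℕ} (hkl : k < l) (hn : k + 1 + l ≤ n)
  (hQ : ∀ j, 1 ≤ j → j ≤ l → Q ^ j ≠ 1)

include hT hQ0 hkl hn hQ

theorem proj_mul_qSymm : proj Q T (k + 1) l * qSymm Q T 1 (k - 1) = proj Q T (k + 1) l :=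
  ((rInv_proj_fst hT hQ0 hn fun j h1 h2 => hQ j h1 (by omega)).mono le_rfl (by omega)).mul_qSymm
    hQ0 fun j h1 h2 => hQ j h1 (by omega)

theorem proj_mul_proj : proj Q T l k * proj Q T l (k + 1) = proj Q T l (k + 1) := by
  rw [proj, mul_assoc, LInv.qSymm_mul ((lInv_proj_snd hT hQ0 (by omega)).mono le_rfl (by omega))
    hQ0 fun j h1 h2 => hQ j h1 (by omega), LInv.qSymm_mul (lInv_proj_fst hT hQ0 (by omega))
    hQ0 fun j h1 h2 => hQ j h1 (by omega)]

omit hQ in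
/-- An ascending product long enough to cross the grid supplies its next row; the surplus
generators commute with the grid and are absorbed on the right. -/
theorem proj_mul_asc_mul {p : ℕ} (hp : p ≤ k) {j : ℕ} (hj : l + p ≤ k + j) (hjl : j ≤ l) :
    proj Q T (k + 1) l * asc T (k + 1) j * grid T k (l + p - k) p * proj Q T l (k + 1) =
      partialBraiding Q T (k + 1) l (p + 1) := by
  obtain ⟨m, rfl⟩ : ∃ m, j = (l + p - k) + m := ⟨j - (l + p - k), by omega⟩
  have hc : Commute (asc T (k + 1 + (l + p - k)) m) (grid T k (l + p - k) p) :=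
    commute_grid fun a h1 h2 => (commute_asc fun b h3 h4 =>
      hT.comm _ _ (by omega) (by omega) (by omega)).symm
  have ha : asc T (k + 1 + (l + p - k)) m * proj Q T l (k + 1) = proj Q T l (k + 1) :=
    ((lInv_proj_snd hT hQ0 (by omega)).mono (by omega) (by omega)).asc_mul
  rw [asc_add, mul_assoc, mul_assoc, mul_assoc (asc _ _ _), ← mul_assoc (asc _ _ m), hc.eq,
    mul_assoc, ha, partialBraiding, grid_succ, Nat.add_sub_cancel,
    show l + (p + 1) - (k + 1) = l + p - k by omega, mul_assoc, mul_assoc]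

omit hQ in
theorem lInv_grid_mul_proj {p : ℕ} (hp : p ≤ k) :
    LInv T (k + 1) (l + p - k - 1) (grid T k (l + p - k) p * proj Q T l (k + 1)) :=
  LInv.grid_mul hT hp (by omega) ((lInv_proj_fst hT hQ0 (by omega)).mono (by omega) (by omega))

/-- A short ascending product moves across the grid and is absorbed on the right; the grid then
loses its first column to the projector on the left. -/
theorem proj_mul_asc_mul' {p : ℕ} (hp : p ≤ k) {j : ℕ} (hj : k + j < l + p) :
    proj Q T (k + 1) l * asc T (k + 1) j * grid T k (l + p - k) p * proj Q T l (k + 1) =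
      partialBraiding Q T (k + 1) l p := by
  have hE := rInv_proj_fst hT hQ0 hn fun j h1 h2 => hQ j h1 (by omega)
  obtain ⟨m, hm⟩ : ∃ m, l + p - k = m + 1 := ⟨l + p - k - 1, by omega⟩
  rw [mul_assoc, mul_assoc, ((lInv_grid_mul_proj hT hQ0 hkl hn hp).mono le_rfl
    (by omega)).asc_mul, ← mul_assoc, hm,
    RInv.mul_grid hT hp (by omega) (hE.mono (by omega) (by omega)), partialBraiding,
    show l + p - (k + 1) = m by omega]

/-- Expanding the symmetriser over cosets, the short coset representatives are absorbed and the
long ones raise the number of braided strands. -/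
theorem proj_mul_proj_mul_grid {p : ℕ} (hp : p ≤ k) :
    proj Q T (k + 1) l * proj Q T k l * grid T k (l + p - k) p * proj Q T l (k + 1) =
      ((Q ^ l - Q ^ (k - p)) / (Q ^ l - 1)) • partialBraiding Q T (k + 1) l p +
      (1 - (Q ^ l - Q ^ (k - p)) / (Q ^ l - 1)) • partialBraiding Q T (k + 1) l (p + 1) := by
  -- `hgeom` and `hZ` evaluate the total weight of the first `m` coset representatives
  have hgeom : ∀ m, (Q - 1) * ∑ j ∈ Finset.range m, (Q ^ j)⁻¹ = Q * (1 - (Q ^ m)⁻¹) := fun m => by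
    induction m with
    | zero => simp
    | succ m ih =>
      rw [Finset.sum_range_succ, mul_add, ih]
      field_simp
      ring
  have hQ1 : Q - 1 ≠ 0 := sub_ne_zero.2 (by simpa using hQ 1 le_rfl (by omega))
  have hQl : Q ^ l - 1 ≠ 0 := sub_ne_zero.2 (hQ l (by omega) le_rfl)
  have hZ : ∀ m, ∑ j ∈ Finset.range m, (Q ^ j)⁻¹ = Q * (1 - (Q ^ m)⁻¹) / (Q - 1) := fun m => by
    rw [← hgeom, mul_div_cancel_left₀ _ hQ1]
  have hcos := cosetSum_qSymm hT hQ0 (i := k + 1) (m := l - 1) (by omega) (by omega)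
    fun j h1 h2 => hQ j h1 (by omega)
  rw [Nat.sub_add_cancel (by omega)] at hcos
  have habs : proj Q T (k + 1) l * qSymm Q T (k + 1 + 1) (l - 1 - 1) = proj Q T (k + 1) l :=
    ((rInv_proj_snd hT hQ0 hn fun j h1 h2 => hQ j h1 (by omega)).mono le_rfl
      (by omega)).mul_qSymm hQ0 fun j h1 h2 => hQ j h1 (by omega)
  have hsplit : ∀ f : ℕ → A, ∑ j ∈ Finset.range l, f j =
      ∑ j ∈ Finset.range (l + p - k), f j + ∑ j ∈ Finset.Ico (l + p - k) l, f j := fun f =>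
    (Finset.sum_range_add_sum_Ico f (by omega)).symm
  have key : (∑ j ∈ Finset.range l, (Q ^ j)⁻¹) •
      (proj Q T (k + 1) l * proj Q T k l * grid T k (l + p - k) p * proj Q T l (k + 1)) =
      (∑ j ∈ Finset.range (l + p - k), (Q ^ j)⁻¹) • partialBraiding Q T (k + 1) l p +
      (∑ j ∈ Finset.Ico (l + p - k) l, (Q ^ j)⁻¹) • partialBraiding Q T (k + 1) l (p + 1) := by
    rw [proj.eq_def Q T k l, ← mul_assoc, proj_mul_qSymm hT hQ0 hkl hn hQ, ← smul_mul_assoc,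
      ← smul_mul_assoc, ← mul_smul_comm, ← hcos, ← mul_assoc, habs, Finset.mul_sum,
      Finset.sum_mul, Finset.sum_mul, hsplit, Finset.sum_smul, Finset.sum_smul]
    congr 1
    · refine Finset.sum_congr rfl fun j hj => ?_
      have := Finset.mem_range.1 hj
      rw [mul_smul_comm, smul_mul_assoc, smul_mul_assoc,
        proj_mul_asc_mul' hT hQ0 hkl hn hQ hp (by omega)]
    · refine Finset.sum_congr rfl fun j hj => ?_
      have := Finset.mem_Ico.1 hj
      rw [mul_smul_comm, smul_mul_assoc, smul_mul_assoc,
        proj_mul_asc_mul hT hQ0 hkl hn hp (by omega) (by omega)]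
  have hQp : Q ^ l = Q ^ (l + p - k) * Q ^ (k - p) := by
    rw [← pow_add]
    congr 1
    omega
  have hZl : ∑ j ∈ Finset.range l, (Q ^ j)⁻¹ ≠ 0 := by
    rw [hZ, show 1 - (Q ^ l)⁻¹ = (Q ^ l - 1) / Q ^ l by field_simp]
    positivity
  have hb : (∑ j ∈ Finset.range l, (Q ^ j)⁻¹) * ((Q ^ l - Q ^ (k - p)) / (Q ^ l - 1)) =
      ∑ j ∈ Finset.range (l + p - k), (Q ^ j)⁻¹ := by
    rw [hQp] at hQl
    rw [hZ, hZ, hQp, ← mul_div_assoc, div_eq_iff hQl]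
    field_simp
  have hI : ∑ j ∈ Finset.Ico (l + p - k) l, (Q ^ j)⁻¹ =
      ∑ j ∈ Finset.range l, (Q ^ j)⁻¹ - ∑ j ∈ Finset.range (l + p - k), (Q ^ j)⁻¹ := by
    rw [eq_sub_iff_add_eq', Finset.sum_range_add_sum_Ico _ (by omega)]
  rw [hI, ← hb] at key
  refine smul_right_injective A hZl ?_
  simp only
  rw [key]
  module

/-- One more row of R-matrices, started at `k + 1` with spectral parameter `v`. -/
theorem proj_mul_ascR_mul {p : ℕ} (hp : p ≤ k) {v : K} (hv : ∀ j, j < l → v * (Q ^ j)⁻¹ ≠ Q) :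
    proj Q T (k + 1) l * ascR Q T (k + 1) l v * partialBraiding Q T k l p *
        proj Q T l (k + 1) =
      ((Q ^ l - Q ^ (k - p)) / (Q ^ l - v)) • partialBraiding Q T (k + 1) l p +
      (1 - (Q ^ l - Q ^ (k - p)) / (Q ^ l - v)) • partialBraiding Q T (k + 1) l (p + 1) := by
  set X := grid T k (l + p - k) p * proj Q T l (k + 1) with hX
  have hX' : partialBraiding Q T k l p * proj Q T l (k + 1) = proj Q T k l * X := by
    rw [partialBraiding, mul_assoc, proj_mul_proj hT hQ0 hkl hn hQ, mul_assoc]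
  have hE := rInv_proj_snd hT hQ0 hn fun j h1 h2 => hQ j h1 (by omega)
  have hY : LInv T (k + 1) (l - 1) (proj Q T k l * X) :=
    (lInv_proj_snd hT hQ0 (by omega)).mul_right X
  have hc : Commute (asc T (k + 1) l) (qSymm Q T 1 (k - 1)) := commute_qSymm _ fun a h1 h2 =>
    (commute_asc fun b h3 h4 => hT.comm _ _ (by omega) (by omega) (by omega)).symm
  have hs : asc T (k + 1) l * qSymm Q T (k + 1) (l - 1) =
      qSymm Q T (k + 1 + 1) (l - 1) * asc T (k + 1) l := semiconj_qSymm Q fun r hr => by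
    have := semiconj_asc hT (i := k + 1) (m := l) (a := k + 1 + r) (by omega) (by omega)
      (by omega) (by omega)
    rwa [show k + 1 + 1 + r = k + 1 + r + 1 by omega]
  have hD : proj Q T (k + 1) l * asc T (k + 1) l * (proj Q T k l * X) =
      partialBraiding Q T (k + 1) l (p + 1) := by
    rw [proj.eq_def Q T k l, mul_assoc, mul_assoc, ← mul_assoc (asc _ _ _), hc.eq, mul_assoc,
      ← mul_assoc (asc _ _ _), hs, ← mul_assoc, proj_mul_qSymm hT hQ0 hkl hn hQ, mul_assoc,
      ← mul_assoc, hE.mul_qSymm hQ0 fun j h1 h2 => hQ j h1 (by omega), hX, ← mul_assoc,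
      ← mul_assoc, proj_mul_asc_mul hT hQ0 hkl hn hp (by omega) le_rfl]
  have hC := proj_mul_proj_mul_grid hT hQ0 hkl hn hQ hp
  rw [mul_assoc _ _ (proj Q T l (k + 1)), ← hX, mul_assoc] at hC
  have hQl : Q ^ l - 1 ≠ 0 := sub_ne_zero.2 (hQ l (by omega) le_rfl)
  have hvl : Q ^ l - v ≠ 0 := by
    intro h
    refine hv (l - 1) (by omega) ?_
    obtain ⟨m, rfl⟩ : ∃ m, l = m + 1 := ⟨l - 1, by omega⟩
    rw [← sub_eq_zero.1 h, Nat.add_sub_cancel]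
    field_simp
    ring
  have hw : rowWeight Q v l = (1 - v) / (Q ^ l - v) := by
    rw [eq_div_iff hvl, mul_comm, mul_rowWeight hQ0 hv]
  rw [mul_assoc, hX', mul_ascR_mul hT (by omega) hn hv hE hY, hD, hC, hw]
  match_scalars
  · field_simp
    ring
  · field_simp
    ring

end step

end IsHeckeFamily

/-! ### The coefficients -/

section coefficients

variable {K : Type*} [Field K]

theorem qFact_succ (x : K) (n : ℕ) : qFact x (n + 1) = qFact x n * qInt x (n + 1) :=
  Finset.prod_Icc_succ_top (by omega) _

theorem qInt_ne_zero {x : K} {n : ℕ} (hx : x ≠ 1) (h : x ^ n ≠ 1) : qInt x n ≠ 0 :=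
  div_ne_zero (sub_ne_zero.2 h.symm) (sub_ne_zero.2 hx.symm)

theorem qFact_ne_zero {x : K} {n : ℕ} (h : ∀ j, 1 ≤ j → j ≤ n → x ^ j ≠ 1) : qFact x n ≠ 0 :=
  Finset.prod_ne_zero_iff.2 fun j hj => by
    rw [Finset.mem_Icc] at hj
    exact qInt_ne_zero (by simpa using h 1 le_rfl (by omega)) (h j hj.1 hj.2)

theorem qBinom_succ_left {x : K} {k p : ℕ} (hp : p ≤ k)
    (h : ∀ j, 1 ≤ j → j ≤ k + 1 → x ^ j ≠ 1) :
    qBinom x k p = (1 - x ^ (k + 1 - p)) / (1 - x ^ (k + 1)) * qBinom x (k + 1) p := by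
  have hx : x ≠ 1 := by simpa using h 1 le_rfl (by omega)
  have h0 : 1 - x ≠ 0 := sub_ne_zero.2 hx.symm
  have h1 : 1 - x ^ (k + 1) ≠ 0 := sub_ne_zero.2 (h _ (by omega) le_rfl).symm
  have h2 : 1 - x ^ (k - p + 1) ≠ 0 := sub_ne_zero.2 (h _ (by omega) (by omega)).symm
  have h3 : qFact x p ≠ 0 := qFact_ne_zero fun j h1 h2 => h j h1 (by omega)
  have h4 : qFact x (k - p) ≠ 0 := qFact_ne_zero fun j h1 h2 => h j h1 (by omega)
  rw [qBinom, qBinom, show k + 1 - p = k - p + 1 by omega, qFact_succ, qFact_succ, qInt, qInt]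
  field_simp

theorem qBinom_succ_succ {x : K} {k p : ℕ} (hp : p ≤ k)
    (h : ∀ j, 1 ≤ j → j ≤ k + 1 → x ^ j ≠ 1) :
    qBinom x k p = (1 - x ^ (p + 1)) / (1 - x ^ (k + 1)) * qBinom x (k + 1) (p + 1) := by
  have hx : x ≠ 1 := by simpa using h 1 le_rfl (by omega)
  have h0 : 1 - x ≠ 0 := sub_ne_zero.2 hx.symm
  have h1 : 1 - x ^ (k + 1) ≠ 0 := sub_ne_zero.2 (h _ (by omega) le_rfl).symm
  have h2 : 1 - x ^ (p + 1) ≠ 0 := sub_ne_zero.2 (h _ (by omega) (by omega)).symm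
  have h3 : qFact x p ≠ 0 := qFact_ne_zero fun j h1 h2 => h j h1 (by omega)
  have h4 : qFact x (k - p) ≠ 0 := qFact_ne_zero fun j h1 h2 => h j h1 (by omega)
  rw [qBinom, qBinom, show k + 1 - (p + 1) = k - p by omega, qFact_succ, qFact_succ, qInt, qInt]
  field_simp

/-- The coefficient of the `p`-th partial braiding, without negative powers. -/
def braidingCoeff (Q u : K) (l k p : ℕ) : K :=
  qBinom Q k p * (((∏ j ∈ Finset.range (k - p), (Q ^ l - Q ^ j)) *
    ∏ j ∈ Finset.range p, (1 - u * Q ^ j)) / ∏ j ∈ Finset.range k, (Q ^ l - u * Q ^ j))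

variable {Q u : K} {l k p : ℕ}

theorem braidingCoeff_mul_left (hp : p ≤ k) (h : ∀ j, 1 ≤ j → j ≤ k + 1 → Q ^ j ≠ 1) :
    braidingCoeff Q u l k p * ((Q ^ l - Q ^ (k - p)) / (Q ^ l - u * Q ^ k)) =
      (1 - Q ^ (k + 1 - p)) / (1 - Q ^ (k + 1)) * braidingCoeff Q u l (k + 1) p := by
  rw [braidingCoeff, braidingCoeff, qBinom_succ_left hp h, Finset.prod_range_succ _ k,
    show k + 1 - p = k - p + 1 by omega, Finset.prod_range_succ _ (k - p)]
  generalize Q ^ l - u * Q ^ k = d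
  ring

theorem braidingCoeff_mul_right (hp : p ≤ k) (h : ∀ j, 1 ≤ j → j ≤ k + 1 → Q ^ j ≠ 1)
    (hu : Q ^ l - u * Q ^ k ≠ 0) :
    braidingCoeff Q u l k p * (1 - (Q ^ l - Q ^ (k - p)) / (Q ^ l - u * Q ^ k)) =
      Q ^ (k - p) * (1 - Q ^ (p + 1)) / (1 - Q ^ (k + 1)) *
        braidingCoeff Q u l (k + 1) (p + 1) := by
  have e : 1 - (Q ^ l - Q ^ (k - p)) / (Q ^ l - u * Q ^ k) =
      Q ^ (k - p) * (1 - u * Q ^ p) / (Q ^ l - u * Q ^ k) := by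
    have : Q ^ k = Q ^ (k - p) * Q ^ p := by rw [← pow_add, Nat.sub_add_cancel hp]
    rw [eq_div_iff hu, sub_mul, div_mul_cancel₀ _ hu, this]
    ring
  rw [e, braidingCoeff, braidingCoeff, qBinom_succ_succ hp h, Finset.prod_range_succ _ k,
    Finset.prod_range_succ _ p, show k + 1 - (p + 1) = k - p by omega]
  generalize Q ^ l - u * Q ^ k = d
  ring

/-- The recursion for the coefficients, in summed form: the shares of `a_p^{(k+1)}` that come
from `a_p^{(k)}` and from `a_{p-1}^{(k)}` add up to `1`. -/
theorem sum_braidingCoeff_succ {M : Type*} [AddCommGroup M] [Module K M] (F : ℕ → M)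
    (h : ∀ j, 1 ≤ j → j ≤ k + 1 → Q ^ j ≠ 1) (hu : Q ^ l - u * Q ^ k ≠ 0) :
    ∑ p ∈ Finset.range (k + 1), braidingCoeff Q u l k p •
      (((Q ^ l - Q ^ (k - p)) / (Q ^ l - u * Q ^ k)) • F p +
        (1 - (Q ^ l - Q ^ (k - p)) / (Q ^ l - u * Q ^ k)) • F (p + 1)) =
    ∑ p ∈ Finset.range (k + 2), braidingCoeff Q u l (k + 1) p • F p := by
  have h1 : 1 - Q ^ (k + 1) ≠ 0 := sub_ne_zero.2 (h _ (by omega) le_rfl).symm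
  have hs : ∑ p ∈ Finset.range (k + 1),
        (braidingCoeff Q u l k p * ((Q ^ l - Q ^ (k - p)) / (Q ^ l - u * Q ^ k))) • F p =
      ∑ p ∈ Finset.range (k + 2),
        ((1 - Q ^ (k + 1 - p)) / (1 - Q ^ (k + 1)) * braidingCoeff Q u l (k + 1) p) • F p := by
    -- the added term with `p = k + 1` has weight `0`
    rw [Finset.sum_range_succ _ (k + 1), Nat.sub_self, pow_zero, sub_self, zero_div, zero_mul,
      zero_smul, add_zero]
    refine Finset.sum_congr rfl fun p hp => ?_
    have := Finset.mem_range.1 hp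
    rw [braidingCoeff_mul_left (by omega) h]
  have ht : ∑ p ∈ Finset.range (k + 1),
        (braidingCoeff Q u l k p * (1 - (Q ^ l - Q ^ (k - p)) / (Q ^ l - u * Q ^ k))) •
          F (p + 1) =
      ∑ p ∈ Finset.range (k + 2), (Q ^ (k + 1 - p) * (1 - Q ^ p) / (1 - Q ^ (k + 1)) *
        braidingCoeff Q u l (k + 1) p) • F p := by
    rw [Finset.sum_range_succ' _ (k + 1), pow_zero, sub_self, mul_zero, zero_div, zero_mul,
      zero_smul, add_zero]
    refine Finset.sum_congr rfl fun p hp => ?_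
    have := Finset.mem_range.1 hp
    rw [braidingCoeff_mul_right (by omega) h hu, show k + 1 - (p + 1) = k - p by omega]
  simp only [smul_add, smul_smul, Finset.sum_add_distrib]
  rw [hs, ht, ← Finset.sum_add_distrib]
  refine Finset.sum_congr rfl fun p hp => ?_
  have := Finset.mem_range.1 hp
  rw [← add_smul, ← add_mul, ← add_div]
  have e : 1 - Q ^ (k + 1 - p) + Q ^ (k + 1 - p) * (1 - Q ^ p) = 1 - Q ^ (k + 1) := by
    rw [mul_sub, ← pow_add, Nat.sub_add_cancel (by omega)]
    ring
  rw [e, div_self h1, one_mul]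

theorem fusedCoeff_eq {q z : K} (hq0 : q ≠ 0) (hp : p ≤ k) :
    fusedCoeff q k l p z = braidingCoeff (q ^ 2) z l k p := by
  have hz : q ^ (-2 * (l : ℤ)) = ((q ^ 2) ^ l)⁻¹ := by
    rw [neg_mul, zpow_neg, zpow_mul]
    norm_cast
  have hz' : q ^ (-2 * (l : ℤ) * (p : ℤ)) = (((q ^ 2) ^ l)⁻¹) ^ p := by
    rw [zpow_mul, hz, zpow_natCast]
  have hQ : (q ^ 2) ^ l ≠ 0 := by positivity
  have e1 : ∀ m, qPoch (((q ^ 2) ^ l)⁻¹) (q ^ 2) m =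
      (((q ^ 2) ^ l)⁻¹) ^ m * ∏ j ∈ Finset.range m, ((q ^ 2) ^ l - (q ^ 2) ^ j) := fun m => by
    rw [qPoch, ← Finset.card_range m, ← Finset.prod_const, Finset.card_range,
      ← Finset.prod_mul_distrib]
    refine Finset.prod_congr rfl fun j _ => ?_
    rw [mul_sub, inv_mul_cancel₀ hQ]
  have e2 : qPoch (z * ((q ^ 2) ^ l)⁻¹) (q ^ 2) k =
      (((q ^ 2) ^ l)⁻¹) ^ k * ∏ j ∈ Finset.range k, ((q ^ 2) ^ l - z * (q ^ 2) ^ j) := by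
    rw [qPoch, ← Finset.card_range k, ← Finset.prod_const, Finset.card_range,
      ← Finset.prod_mul_distrib]
    refine Finset.prod_congr rfl fun j _ => ?_
    rw [mul_sub, inv_mul_cancel₀ hQ]
    ring
  have e3 : (((q ^ 2) ^ l)⁻¹) ^ k = (((q ^ 2) ^ l)⁻¹) ^ p * (((q ^ 2) ^ l)⁻¹) ^ (k - p) := by
    rw [← pow_add]
    congr 1
    omega
  rw [fusedCoeff, braidingCoeff, hz, hz', e1, e2, e3, qPoch]
  generalize hc : (((q ^ 2) ^ l)⁻¹) = c
  have hc0 : c ≠ 0 := by rw [← hc]; exact inv_ne_zero hQ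
  rw [mul_assoc (c ^ p) (c ^ (k - p)), mul_assoc (c ^ (k - p)) (∏ j ∈ _, _),
    mul_assoc (qBinom _ _ _)]
  congr 1
  rw [← mul_div_assoc, mul_div_mul_left _ _ (pow_ne_zero _ hc0),
    mul_div_mul_left _ _ (pow_ne_zero _ hc0)]

theorem fusedCoeff_eq_qHahn {q z : K} (hq0 : q ≠ 0) :
    fusedCoeff q k l p z = qHahn q (q ^ (-2 * (l : ℤ))) (z * q ^ (-2 * (l : ℤ))) k p := by
  rw [fusedCoeff, qHahn, mul_div_cancel_right₀ _ (zpow_ne_zero _ hq0), zpow_mul, zpow_natCast]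

end coefficients

/-! ### The expansion in the Hecke algebra -/

namespace IsHeckeFamily

variable {K A : Type*} [Field K] [Ring A] [Algebra K A]
variable {n : ℕ} {Q : K} {T : ℕ → A}

/-- Induction on `k`, peeling off the leftmost row of R-matrices. -/
theorem proj_mul_rows_mul_proj (hT : IsHeckeFamily n Q T) (hQ0 : Q ≠ 0) {k l : ℕ} (hkl : k ≤ l)
    (hn : k + l ≤ n) (hQ : ∀ j, 1 ≤ j → j ≤ l → Q ^ j ≠ 1) {u : K}
    (hu : ∀ a j, a < k → j < l → u * Q ^ a * (Q ^ j)⁻¹ ≠ Q) :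
    proj Q T k l * rows Q T l u k * proj Q T l k =
      ∑ p ∈ Finset.range (k + 1), braidingCoeff Q u l k p • partialBraiding Q T k l p := by
  induction k with
  | zero => simp [rows, partialBraiding, grid_zero, braidingCoeff, qBinom, qFact]
  | succ k ih =>
    have ih := ih (by omega) (by omega) fun a j h1 h2 => hu a j (by omega) h2
    have hpp := proj_mul_proj hT hQ0 (k := k) (by omega) hn hQ
    have hps := proj_mul_qSymm hT hQ0 (k := k) (by omega) hn hQ
    set B := rows Q T l u k * proj Q T l k with hB
    have hc : Commute (ascR Q T (k + 1) l (u * Q ^ k)) (qSymm Q T 1 (k - 1)) :=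
      commute_qSymm _ fun a h1 h2 => (commute_ascR _ _ fun b h3 h4 =>
        hT.comm _ _ (by omega) (by omega) (by omega)).symm
    have hBinv : qSymm Q T (k + 1) (l - 1) * B = B :=
      (lInv_rows hT hQ0 (by omega) u (lInv_proj_fst hT hQ0 (by omega))).qSymm_mul hQ0
        fun j h1 h2 => hQ j h1 (by omega)
    -- the projector on fewer strands is inserted between the new row and the others
    have hins : proj Q T (k + 1) l * ascR Q T (k + 1) l (u * Q ^ k) * B =
        proj Q T (k + 1) l * ascR Q T (k + 1) l (u * Q ^ k) * (proj Q T k l * B) := by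
      conv_lhs => rw [← hps, mul_assoc (proj Q T (k + 1) l), ← hc.eq, ← hBinv]
      rw [proj.eq_def Q T k l]
      simp only [mul_assoc]
    have hul : Q ^ l - u * Q ^ k ≠ 0 := by
      intro h
      refine hu k (l - 1) (by omega) (by omega) ?_
      obtain ⟨m, rfl⟩ : ∃ m, l = m + 1 := ⟨l - 1, by omega⟩
      rw [← sub_eq_zero.1 h, Nat.add_sub_cancel, pow_succ, mul_comm (Q ^ m),
        mul_inv_cancel_right₀ (pow_ne_zero _ hQ0)]
    rw [← sum_braidingCoeff_succ _ (fun j h1 h2 => hQ j h1 (by omega)) hul]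
    rw [rows, ← hpp, ← mul_assoc, mul_assoc _ _ (proj Q T l k), mul_assoc _ _ (proj Q T l k),
      ← hB, ← mul_assoc, hins, hB, ← mul_assoc (proj Q T k l), ih, Finset.mul_sum, Finset.sum_mul]
    refine Finset.sum_congr rfl fun p hp => ?_
    have := Finset.mem_range.1 hp
    rw [mul_smul_comm, smul_mul_assoc, proj_mul_ascR_mul hT hQ0 (by omega) hn hQ (by omega)
      fun j hj => hu k j (by omega) hj]

end IsHeckeFamily

namespace HeckeAlgebra

open MulOpposite IsHeckeFamily

variable {K : Type*} [Field K]

theorem isHeckeFamily_stochSigma (n : ℕ) {q : K} (hq0 : q ≠ 0) :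
    IsHeckeFamily n (q ^ 2) (stochSigma n q) where
  quadratic i h1 h2 := by
    have h := RingQuot.mkAlgHom_rel K (HeckeRel.quadratic (q := q) ⟨i, h1, h2⟩)
    rw [map_mul, map_add, map_smul, map_one] at h
    have hi : i ∈ Set.Ico 1 n := ⟨h1, h2⟩
    simp only [stochSigma, sigma, dif_pos hi, smul_mul_smul_comm, h]
    match_scalars <;> field_simp
    ring
  braid i h1 h2 := by
    have h := RingQuot.mkAlgHom_rel K (HeckeRel.braid (q := q) (n := n) ⟨i, h1, by omega⟩
      ⟨i + 1, by omega, h2⟩ rfl)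
    simp only [map_mul] at h
    have hi : i ∈ Set.Ico 1 n := ⟨h1, by omega⟩
    have hi' : i + 1 ∈ Set.Ico 1 n := ⟨by omega, h2⟩
    simp only [stochSigma, sigma, dif_pos hi, dif_pos hi', smul_mul_smul_comm, h]
  comm i j h1 h2 h3 := by
    have h := RingQuot.mkAlgHom_rel K (HeckeRel.comm (q := q) (n := n) ⟨i, h1, by omega⟩
      ⟨j, by omega, h3⟩ h2)
    simp only [map_mul] at h
    have hi : i ∈ Set.Ico 1 n := ⟨h1, by omega⟩
    have hj : j ∈ Set.Ico 1 n := ⟨by omega, h3⟩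
    simp only [Commute, SemiconjBy, stochSigma, sigma, dif_pos hi, dif_pos hj,
      smul_mul_smul_comm, h]

theorem stochR_eq_rmat (n : ℕ) (q : K) (i : ℕ) (v : K) :
    stochR n q i v = rmat (q ^ 2) (stochSigma n q) i v := rfl

theorem stochS_eq_qSymm (n : ℕ) {q : K} (hq0 : q ≠ 0) {i j : ℕ} (hi : 1 ≤ i) (hij : i ≤ j)
    (hjn : j ≤ n) (hQ : ∀ m, 1 ≤ m → m ≤ j - i + 1 → (q ^ 2) ^ m ≠ 1) :
    stochS n q i j = qSymm (q ^ 2) (stochSigma n q) i (j - i) := by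
  rw [← unop_qSymm (isHeckeFamily_stochSigma n hq0) (pow_ne_zero 2 hq0) hi (by omega) hQ, stochS]
  generalize j - i = m
  induction m with
  | zero => simp [qSymm]
  | succ m ih =>
    rw [List.range'_concat, List.map_append, List.prod_append, ih, qSymm, unop_mul]
    congr 1
    simp only [List.map_cons, List.map_nil, List.prod_cons, List.prod_nil, mul_one, one_mul,
      Nat.add_sub_cancel_left]
    rw [ascR, unop_list_prod, List.map_map, List.map_reverse, List.range'_eq_map_range,
      List.map_map]
    congr 2
    refine List.map_congr_left fun r _ => ?_
    have e : q ^ (-2 * (((i + r : ℕ) : ℤ) - (i : ℤ) + 1)) = (q ^ 2)⁻¹ * ((q ^ 2) ^ r)⁻¹ := by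
      rw [← mul_inv, ← pow_succ', ← pow_mul, ← zpow_natCast, ← zpow_neg]
      congr 1
      push_cast
      ring
    simp only [Function.comp_apply, e, stochR_eq_rmat]
    rfl

theorem stochP_eq_proj {q : K} (hq0 : q ≠ 0) {n a b : ℕ} (ha : 1 ≤ a) (hb : 1 ≤ b)
    (hab : a + b ≤ n) (hQ : ∀ m, 1 ≤ m → m ≤ max a b → (q ^ 2) ^ m ≠ 1) :
    stochP n q a b = proj (q ^ 2) (stochSigma n q) a b := by
  rw [stochP, stochS_eq_qSymm n hq0 le_rfl ha (by omega) fun m h1 h2 => hQ m h1 (by omega),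
    stochS_eq_qSymm n hq0 (by omega) (by omega) hab fun m h1 h2 => hQ m h1 (by omega), proj,
    show a + b - (a + 1) = b - 1 by omega]

theorem prod_rows_eq (n : ℕ) {q : K} (hq0 : q ≠ 0) (k l : ℕ) (u : K) :
    ((List.range' 1 k).reverse.map fun a =>
      ((List.range' 1 l).map fun j =>
        stochR n q (a + j - 1) (u * q ^ (-2 * ((j : ℤ) - (a : ℤ))))).prod).prod =
    rows (q ^ 2) (stochSigma n q) l u k := by
  induction k with
  | zero => simp [rows]
  | succ k ih =>
    rw [List.range'_concat, List.reverse_append, List.map_append, List.prod_append, ih, rows]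
    congr 1
    simp only [List.reverse_cons, List.reverse_nil, List.nil_append, List.map_cons, List.map_nil,
      List.prod_cons, List.prod_nil, mul_one, one_mul]
    rw [ascR, List.range'_eq_map_range, List.map_map]
    congr 1
    refine List.map_congr_left fun r _ => ?_
    have e : q ^ (-2 * (((1 + r : ℕ) : ℤ) - ((1 + k : ℕ) : ℤ))) =
        (q ^ 2) ^ k * ((q ^ 2) ^ r)⁻¹ := by
      rw [← pow_mul, ← pow_mul, ← zpow_natCast, ← zpow_natCast, ← zpow_neg, ← zpow_add₀ hq0]
      congr 1
      push_cast
      ring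
    simp only [Function.comp_apply, e, stochR_eq_rmat, ← mul_assoc]
    congr 1
    omega

theorem stochPartialBraiding_eq {q : K} (hq0 : q ≠ 0) {k l : ℕ} (hk : 1 ≤ k) (hkl : k ≤ l)
    (hQ : ∀ m, 1 ≤ m → m ≤ l → (q ^ 2) ^ m ≠ 1) (p : ℕ) :
    stochPartialBraiding q k l p = partialBraiding (q ^ 2) (stochSigma (k + l) q) k l p := by
  rw [stochPartialBraiding, partialBraiding, grid,
    stochP_eq_proj hq0 hk (by omega) le_rfl fun m h1 h2 => hQ m h1 (by omega),
    stochP_eq_proj hq0 (by omega) hk (by omega) fun m h1 h2 => hQ m h1 (by omega)]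
  simp only [asc, List.range'_eq_map_range, List.map_map]
  rfl

end HeckeAlgebra

open IsHeckeFamily HeckeAlgebra in
theorem mainTheorem1 {K : Type*} [Field K] (q : K) (hq0 : q ≠ 0) (k l : ℕ)
    (hk : 1 ≤ k) (hkl : k ≤ l)
    (hq : ∀ m : ℕ, 1 ≤ m → m ≤ l → q ^ (2 * m) ≠ 1) :
    (∀ z : K, (∀ j : ℕ, j < k → q ^ (2 * l) - z * q ^ (2 * j) ≠ 0) →
      ∀ p : ℕ, p ≤ k →
        fusedCoeff q k l p z =
          qBinom (q ^ 2) k p *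
            (((∏ j ∈ Finset.range (k - p), (q ^ (2 * l) - q ^ (2 * j))) *
                ∏ j ∈ Finset.range p, (1 - z * q ^ (2 * j))) /
              ∏ j ∈ Finset.range k, (q ^ (2 * l) - z * q ^ (2 * j))) ∧
        fusedCoeff q k l p z =
          qHahn q (q ^ (-2 * (l : ℤ))) (z * q ^ (-2 * (l : ℤ))) k p) ∧
    (∀ u : K, (∀ m : ℤ, 2 - (k : ℤ) ≤ m → m ≤ (l : ℤ) → u ≠ q ^ (2 * m)) →
      HeckeAlgebra.stochFusedR q k l u =
        ∑ p ∈ Finset.range (k + 1),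
          fusedCoeff q k l p u • HeckeAlgebra.stochPartialBraiding q k l p) := by
  have hQ : ∀ m : ℕ, 1 ≤ m → m ≤ l → (q ^ 2) ^ m ≠ 1 := fun m h1 h2 => by
    rw [← pow_mul]
    exact hq m h1 h2
  refine ⟨fun z _ p hp => ⟨?_, fusedCoeff_eq_qHahn hq0⟩, fun u hu => ?_⟩
  · simp only [fusedCoeff_eq hq0 hp, braidingCoeff, pow_mul]
  · rw [stochFusedR, prod_rows_eq _ hq0,
      stochP_eq_proj hq0 hk (by omega) le_rfl fun m h1 h2 => hQ m h1 (by omega),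
      stochP_eq_proj hq0 (by omega) hk (by omega) fun m h1 h2 => hQ m h1 (by omega),
      proj_mul_rows_mul_proj (isHeckeFamily_stochSigma _ hq0) (pow_ne_zero 2 hq0) hkl le_rfl hQ]
    · refine Finset.sum_congr rfl fun p hp => ?_
      rw [fusedCoeff_eq hq0 (by simpa [Nat.lt_succ_iff] using hp),
        stochPartialBraiding_eq hq0 hk hkl hQ]
    · intro a j ha hj h
      -- the R-matrix in row `a + 1` and column `j + 1` has its pole at `u = q^{2(j - a + 1)}`
      refine hu ((j : ℤ) - a + 1) (by omega) (by omega) ?_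
      have e : q ^ (2 * ((j : ℤ) - a + 1)) = q ^ 2 * (q ^ 2) ^ j * ((q ^ 2) ^ a)⁻¹ := by
        rw [← pow_mul, ← pow_mul, ← zpow_natCast, ← zpow_natCast, ← zpow_natCast, ← zpow_neg,
          ← zpow_add₀ hq0, ← zpow_add₀ hq0]
        congr 1
        push_cast
        ring
      have h1 : (q ^ 2) ^ a ≠ 0 := pow_ne_zero _ (pow_ne_zero _ hq0)
      have h2 : (q ^ 2) ^ j ≠ 0 := pow_ne_zero _ (pow_ne_zero _ hq0)
      rw [← div_eq_mul_inv, div_eq_iff h2] at h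
      rw [e, eq_mul_inv_iff_mul_eq₀ h1, h]
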